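/- **Proposition 3.** An index coding problem is given by a finite directed graph $G$ (the side information graph) on a vertex set $V$, without self-loops: the vertices are the messages and their receivers, and an edge $i\to j$ means that receiver $j$ knows message $i$, so that its side information set is $A_j=\{i : i\to j\}\subseteq V\setminus\{j\}$. For integers $t_j\ge 0$ ($j\in V$) and $r\ge 1$, a $((t_j)_{j\in V},r)$ index code consists of an encoder $\phi:\prod_{i\in V}\{0,1\}^{t_i}\to\{0,1\}^r$ and decoders $\psi_j:\{0,1\}^r\times\prod_{k\in A_j}\{0,1\}^{t_k}\to\{0,1\}^{t_j}$, $j\in V$, such that $\psi_j(\phi(x),(x_k)_{k\in A_j})=x_j$ for every $x\in\prod_{i\in V}\{0,1\}^{t_i}$ and every $j\in V$. A tuple $(R_j)_{j\in V}$ of nonnegative real numbers is achievable if there is a $((t_j)_{j\in V},r)$ index code with $R_j\le t_j/r$ for all $j\in V$, and the capacity region of $G$ is the closure in $\mathbb{R}^V$ of the set of achievable tuples. Let $V=V_1\cup V_2$ with $V_1\cap V_2=\emptyset$, let $G_1$ and $G_2$ be the subgraphs of $G$ induced by $V_1$ and $V_2$, and let $\mathscr{C}$, $\mathscr{C}_1$,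 $\mathscr{C}_2$ be the capacity regions of $G$, $G_1$, $G_2$. If $G$ has no edge between $V_1$ and $V_2$ (in either direction), then \[ \mathscr{C}=\bigcup_{\alpha\in[0,1]}\bigl\{(\alpha\mathbf{R}_1,(1-\alpha)\mathbf{R}_2) : \mathbf{R}_1\in\mathscr{C}_1,\ \mathbf{R}_2\in\mathscr{C}_2\bigr\}, \] where $(\mathbf{S}_1,\mathbf{S}_2)$ denotes the tuple in $\mathbb{R}^V$ whose coordinates on $V_i$ are those of $\mathbf{S}_i\in\mathbb{R}^{V_i}$. -/

import Mathlib

namespace IndexCoding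

/-- The side information set `A_j` of receiver `j` in the side information graph `G`:
an edge `i → j` means that receiver `j` knows message `i`. -/
def sideInfoSet {V : Type*} (G : Digraph V) (j : V) : Set V := {i | G.Adj i j}

/-- The vertex-induced subgraph of `G` on the vertex set `S`. -/
def inducedSubgraph {V : Type*} (G : Digraph V) (S : Set V) : Digraph S where
  Adj i j := G.Adj i j

/-- Bit strings of length `t`. -/
abbrev BitString (t : ℕ) : Type := Fin t → Bool

/-- An index code with message lengths `t` and index length `r` for the index coding problem
`G`: an encoder, and for each receiver a decoder that recovers its message from the index and
the side information. -/
structure IndexCode {V : Type*} (G : Digraph V) (t : V → ℕ) (r : ℕ) where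
  /-- The encoder. -/
  encode : (∀ i, BitString (t i)) → BitString r
  /-- The decoders. -/
  decode : ∀ j, BitString r → (∀ k : sideInfoSet G j, BitString (t k)) → BitString (t j)
  /-- Every receiver recovers its message. -/
  decode_encode : ∀ (x : ∀ i, BitString (t i)) (j : V),
    decode j (encode x) (fun k => x k) = x j

/-- The tuple of (nonnegative) rates `R` is achievable for the index coding problem `G`. -/
def Achievable {V : Type*} (G : Digraph V) (R : V → ℝ) : Prop :=
  (∀ j, 0 ≤ R j) ∧
    ∃ (t : V → ℕ) (r : ℕ), 0 < r ∧ Nonempty (IndexCode G t r) ∧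
      ∀ j, R j ≤ (t j : ℝ) / (r : ℝ)

/-- The capacity region: the closure of the set of achievable rate tuples. -/
def capacityRegion {V : Type*} (G : Digraph V) : Set (V → ℝ) :=
  closure {R | Achievable G R}

end IndexCoding

/-! Call a set of message tuples confusion-free if a single codeword could serve all of it. Some
fibre of a length-`r` code has density at least `2 ^ (-r)`. As no edge crosses, its projections to
`V₁` and `V₂` are again confusion-free, and the product of their densities is at least `2 ^ (-r)`
(`IndexCode.exists_confusionFree`). So the densities are `2 ^ (-ρ)` and at least `2 ^ (-(r - ρ))`,
and `α = ρ / r` is the weight sought.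

One confusion-free set is enough to build codes: translates of its `n`-th power are confusion-free,
and a greedy choice covers all of `X ^ n` by about `2 ^ (n * ρ)` of them, up to a factor linear in
`n`, which costs no rate (`ConfusionFree.achievable`).

The other inclusion is time sharing. Compactness of the two regions and continuity of the pairing
handle the closures. -/

namespace IndexCoding

/-! ### Covering a finite group by translates -/

open Finset in
/-- Greedy covering of a finite group by few translates of a subset. -/
theorem exists_translates_card_uncovered_le {Γ : Type*} [AddCommGroup Γ] [Fintype Γ]
    [DecidableEq Γ] (A : Finset Γ) (m : ℕ) :
    ∃ g : Fin m → Γ, ((#{x | ∀ l, x - g l ∉ A} : ℕ) : ℝ) ≤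
      Fintype.card Γ * (1 - (#A : ℝ) / Fintype.card Γ) ^ m := by
  have hΓ : (0 : ℝ) < Fintype.card Γ := by exact_mod_cast Fintype.card_pos
  have hA : (#A : ℝ) ≤ Fintype.card Γ := by exact_mod_cast card_le_univ A
  induction m with
  | zero => exact ⟨Fin.elim0, by simp⟩
  | succ m ih =>
    obtain ⟨g, hg⟩ := ih
    set U : Finset Γ := {x | ∀ l, x - g l ∉ A} with hU
    -- Each `x` lies in exactly `#A` translates, so some translate covers at least the average share
    -- of `U`.
    have hcount : ∑ a : Γ, #{x ∈ U | x - a ∈ A} = #U * #A := by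
      simp_rw [card_filter]
      rw [sum_comm, ← smul_eq_mul, ← sum_const]
      refine sum_congr rfl fun x _ => ?_
      rw [← card_filter]
      refine card_bij (fun a _ => x - a) (by simp) (by simp) fun b hb => ⟨x - b, by simpa, by simp⟩
    obtain ⟨a, -, ha⟩ : ∃ a ∈ (univ : Finset Γ),
        (#U * #A : ℝ) / Fintype.card Γ ≤ #{x ∈ U | x - a ∈ A} := by
      refine exists_le_of_sum_le univ_nonempty ?_
      rw [sum_const, card_univ, nsmul_eq_mul, mul_div_cancel₀ _ hΓ.ne']
      exact_mod_cast hcount.ge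
    refine ⟨Fin.cons a g, ?_⟩
    have hsplit : #{x | ∀ l, x - (Fin.cons a g : Fin (m + 1) → Γ) l ∉ A}
        + #{x ∈ U | x - a ∈ A} = #U := by
      rw [← card_filter_add_card_filter_not (s := U) (fun x => x - a ∈ A), add_comm]
      congr 2
      ext x
      simp [hU, Fin.forall_fin_succ, and_comm]
    have hsplit' : (#{x | ∀ l, x - (Fin.cons a g : Fin (m + 1) → Γ) l ∉ A} : ℝ)
        + #{x ∈ U | x - a ∈ A} = #U := by exact_mod_cast hsplit
    calc (#{x | ∀ l, x - (Fin.cons a g : Fin (m + 1) → Γ) l ∉ A} : ℝ)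
        ≤ #U * (1 - (#A : ℝ) / Fintype.card Γ) := by
          rw [mul_sub, mul_one, ← mul_div_assoc]; linarith
      _ ≤ (Fintype.card Γ * (1 - (#A : ℝ) / Fintype.card Γ) ^ m)
            * (1 - (#A : ℝ) / Fintype.card Γ) := by
          gcongr
          rw [sub_nonneg, div_le_one hΓ]; exact hA
      _ = _ := by ring

-- With `p` the density of `A`, fewer than `exp (L - m * p) ≤ 1` points stay uncovered, hence none.
open Finset in
theorem exists_translates_cover {Γ : Type*} [AddCommGroup Γ] [Fintype Γ] [DecidableEq Γ]
    (A : Finset Γ) (m : ℕ) (L : ℝ) (hL : (Fintype.card Γ : ℝ) < Real.exp L)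
    (hm : L * Fintype.card Γ ≤ m * #A) :
    ∃ g : Fin m → Γ, ∀ x, ∃ l, x - g l ∈ A := by
  obtain ⟨g, hg⟩ := exists_translates_card_uncovered_le A m
  refine ⟨g, ?_⟩
  have hΓ : (0 : ℝ) < Fintype.card Γ := by exact_mod_cast Fintype.card_pos
  have hA : (#A : ℝ) ≤ Fintype.card Γ := by exact_mod_cast card_le_univ A
  set p : ℝ := (#A : ℝ) / Fintype.card Γ with hp
  have hp1 : p ≤ 1 := (div_le_one hΓ).2 hA
  have hLp : L ≤ m * p := by rw [hp, ← mul_div_assoc, le_div_iff₀ hΓ]; exact hm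
  have hlt : (Fintype.card Γ : ℝ) * (1 - p) ^ m < 1 := by
    calc (Fintype.card Γ : ℝ) * (1 - p) ^ m
        ≤ Fintype.card Γ * Real.exp (-p) ^ m := by
          gcongr
          linarith [Real.add_one_le_exp (-p)]
      _ < Real.exp L * Real.exp (-p) ^ m := by gcongr
      _ = Real.exp (L - m * p) := by rw [← Real.exp_nat_mul, ← Real.exp_add]; ring_nf
      _ ≤ 1 := Real.exp_le_one_iff.2 (by linarith)
  have h0 : #{x | ∀ l, x - g l ∉ A} = 0 := by
    have := hg.trans_lt hlt
    exact Nat.lt_one_iff.1 (by exact_mod_cast this)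
  intro x
  by_contra! hx
  have : x ∈ ({x | ∀ l, x - g l ∉ A} : Finset Γ) := by simpa using hx
  rw [card_eq_zero.1 h0] at this
  simp at this

/-! ### Confusion-free sets and codes as separating maps -/

/-- A set of message tuples no two of which are confusable by a receiver: such a tuple is
determined at `j` by its entries on the side information set of `j`. -/
def ConfusionFree {V : Type*} (G : Digraph V) {X : V → Type*} (S : Set (∀ i, X i)) : Prop :=
  ∀ x ∈ S, ∀ z ∈ S, ∀ j, (∀ k, G.Adj k j → x k = z k) → x j = z j

/-- A map whose fibres are confusion-free, i.e. an index code over arbitrary alphabets. -/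
def Separates {V : Type*} (G : Digraph V) {X : V → Type*} {C : Type*} (f : (∀ i, X i) → C) :
    Prop :=
  ∀ x z, f x = f z → ∀ j, (∀ k, G.Adj k j → x k = z k) → x j = z j

theorem IndexCode.separates {V : Type*} {G : Digraph V} {t : V → ℕ} {r : ℕ}
    (c : IndexCode G t r) : Separates G c.encode := by
  intro x z h j hk
  rw [← c.decode_encode x j, ← c.decode_encode z j, h]
  congr 1
  funext k
  exact hk k k.2

theorem Separates.confusionFree {V : Type*} {G : Digraph V} {X : V → Type*} {C : Type*}
    {f : (∀ i, X i) → C} (hf : Separates G f) (y : C) : ConfusionFree G {x | f x = y} :=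
  fun _ hx _ hz => hf _ _ (hx.trans hz.symm)

theorem Separates.comp_injective {V : Type*} {G : Digraph V} {X : V → Type*} {C D : Type*}
    {f : (∀ i, X i) → C} (hf : Separates G f) {e : C → D} (he : Function.Injective e) :
    Separates G (e ∘ f) :=
  fun _ _ h => hf _ _ (he h)

theorem Separates.comp_equiv {V : Type*} {G : Digraph V} {X Y : V → Type*} {C : Type*}
    {f : (∀ i, X i) → C} (hf : Separates G f) (e : ∀ i, Y i ≃ X i) :
    Separates G (fun y => f fun i => e i (y i)) :=
  fun _ _ h j hk => (e j).injective (hf _ _ h j fun k hkj => congrArg (e k) (hk k hkj))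

theorem Separates.pi {V ι : Type*} {G : Digraph V} {X : V → Type*} {C : Type*}
    {f : (∀ i, X i) → C} (hf : Separates G f) :
    Separates G (fun (x : ∀ i, ι → X i) (l : ι) => f fun i => x i l) := by
  intro x z h j hk
  funext l
  exact hf _ _ (congrFun h l) j fun k hkj => congrFun (hk k hkj) l

/-- The decoder picks any tuple consistent with what it sees; separation makes the `j`-th entry
unambiguous. -/
theorem nonempty_indexCode_of_separates {V : Type*} {G : Digraph V} {t : V → ℕ} {r : ℕ}
    {f : (∀ i, BitString (t i)) → BitString r} (hf : Separates G f) :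
    Nonempty (IndexCode G t r) := by
  classical
  refine ⟨⟨f, fun j y s => if h : ∃ x, f x = y ∧ ∀ k : sideInfoSet G j, x k = s k
    then h.choose j else default, fun x j => ?_⟩⟩
  have h : ∃ x', f x' = f x ∧ ∀ k : sideInfoSet G j, x' k = x k := ⟨x, rfl, fun _ => rfl⟩
  rw [dif_pos h]
  exact hf _ _ h.choose_spec.1 j fun k hk => h.choose_spec.2 ⟨k, hk⟩

theorem Separates.nonempty_indexCode {V : Type*} {G : Digraph V} {X : V → Type*} {C : Type*}
    [Fintype C] {f : (∀ i, X i) → C} (hf : Separates G f) {t : V → ℕ} {r : ℕ}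
    (e : ∀ i, BitString (t i) ≃ X i) (hC : Fintype.card C ≤ 2 ^ r) :
    Nonempty (IndexCode G t r) := by
  obtain ⟨g⟩ : Nonempty (C ↪ BitString r) :=
    Function.Embedding.nonempty_of_card_le (by simpa using hC)
  exact nonempty_indexCode_of_separates ((hf.comp_equiv e).comp_injective g.injective)

/-- A bit string of length `n * t` is a sequence of `n` bit strings of length `t`. -/
def bitStringMulEquiv (n t : ℕ) : BitString (n * t) ≃ (Fin n → BitString t) :=
  (Equiv.arrowCongr finProdFinEquiv.symm (Equiv.refl Bool)).trans
    (Equiv.curry (Fin n) (Fin t) Bool)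

/-- Repeating a code `n` times. -/
theorem IndexCode.nonempty_nsmul {V : Type*} {G : Digraph V} {t : V → ℕ} {r : ℕ}
    (c : IndexCode G t r) (n : ℕ) : Nonempty (IndexCode G (fun j => n * t j) (n * r)) :=
  (c.separates.pi (ι := Fin n)).nonempty_indexCode (fun i => bitStringMulEquiv n (t i))
    (by simp [← pow_mul, mul_comm])

/-- With all other messages frozen, receiver `j` sees constant side information, so the codeword
alone determines message `j`. -/
theorem IndexCode.length_le {V : Type*} {G : Digraph V} (hloop : ∀ j, ¬ G.Adj j j)
    {t : V → ℕ} {r : ℕ} (c : IndexCode G t r) (j : V) : t j ≤ r := by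
  classical
  have hinj : Function.Injective
      (fun b : BitString (t j) => c.encode (Function.update default j b)) := by
    intro b b' h
    have := c.separates _ _ h j fun k hk => by
      have : k ≠ j := by rintro rfl; exact hloop _ hk
      simp [this]
    simpa using this
  have := Fintype.card_le_of_injective _ hinj
  exact (Nat.pow_le_pow_iff_right one_lt_two).1 (by simpa using this)

/-- Concatenating codes for two vertex-disjoint induced subgraphs. -/
theorem nonempty_indexCode_union {V : Type*} {G : Digraph V} {V₁ V₂ : Set V}
    (hcover : V₁ ∪ V₂ = Set.univ) {t : V → ℕ} {r₁ r₂ : ℕ}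
    (c₁ : IndexCode (inducedSubgraph G V₁) (fun j => t j) r₁)
    (c₂ : IndexCode (inducedSubgraph G V₂) (fun j => t j) r₂) :
    Nonempty (IndexCode G t (r₁ + r₂)) := by
  have hsep : Separates G (fun x : ∀ i, BitString (t i) =>
      (c₁.encode (fun i => x i), c₂.encode (fun i => x i))) := by
    intro x z h j hk
    rw [Prod.mk.injEq] at h
    rcases (hcover ▸ Set.mem_univ j : j ∈ V₁ ∪ V₂) with hj | hj
    · exact c₁.separates _ _ h.1 ⟨j, hj⟩ fun k hkj => hk k hkj
    · exact c₂.separates _ _ h.2 ⟨j, hj⟩ fun k hkj => hk k hkj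
  exact hsep.nonempty_indexCode (fun i => Equiv.refl _) (by simp [pow_add])

/-! ### Rates from a confusion-free set -/

open Finset in
/-- Translates of powers of a confusion-free set are the fibres of a code. -/
theorem ConfusionFree.exists_separates_pi {V : Type*} [Fintype V] [DecidableEq V] {G : Digraph V}
    {X : V → Type*} [∀ i, AddCommGroup (X i)] [∀ i, Fintype (X i)] [∀ i, DecidableEq (X i)]
    {S : Finset (∀ i, X i)} (hS : ConfusionFree G (S : Set (∀ i, X i))) (n m : ℕ) (L : ℝ)
    (hL : (Fintype.card (∀ i, X i) : ℝ) ^ n < Real.exp L)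
    (hm : L * (Fintype.card (∀ i, X i) : ℝ) ^ n ≤ m * (#S : ℝ) ^ n) :
    ∃ f : (∀ i, Fin n → X i) → Fin m, Separates G f := by
  have hcard : Fintype.card (Fin n → ∀ i, X i) = Fintype.card (∀ i, X i) ^ n := by simp
  obtain ⟨g, hg⟩ := exists_translates_cover (Γ := Fin n → ∀ i, X i)
    (Fintype.piFinset fun _ => S) m L (by rw [hcard]; exact_mod_cast hL)
    (by rw [hcard, Fintype.card_piFinset_const]; exact_mod_cast hm)
  choose l hl using hg
  refine ⟨fun x => l fun a i => x i a, fun x z h j hk => ?_⟩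
  funext a
  have hx := Fintype.mem_piFinset.1 (hl fun a i => x i a) a
  have hz := Fintype.mem_piFinset.1 (hl fun a i => z i a) a
  simp only at h
  rw [← h] at hz
  -- Both tuples lie in the same translate, and confusability is translation invariant.
  have := hS _ (mem_coe.2 hx) _ (mem_coe.2 hz) j fun k hkj => by simp [hk k hkj]
  simpa using this


open Filter Topology in
/-- A confusion-free set `S` yields codes of every index rate above `logb 2 (|X| / |S|)`. -/
theorem ConfusionFree.achievable {V : Type*} [Finite V] {G : Digraph V} {t : V → ℕ}
    {S : Set (∀ i, BitString (t i))} (hS : ConfusionFree G S) {σ : ℝ} (hσ : 0 < σ)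
    (hcard : (Nat.card (∀ i, BitString (t i)) : ℝ) < 2 ^ σ * S.ncard)
    {R : V → ℝ} (hR : ∀ j, 0 ≤ R j) (hRt : ∀ j, R j * σ ≤ t j) : Achievable G R := by
  classical
  have := Fintype.ofFinite V
  lift S to Finset (∀ i, BitString (t i)) using S.toFinite
  rw [Set.ncard_coe_finset, Nat.card_eq_fintype_card] at hcard
  set N : ℝ := (Fintype.card (∀ i, BitString (t i)) : ℝ) with hN
  set a : ℝ := (S.card : ℝ) with ha
  have hN0 : 0 < N := by rw [hN]; exact_mod_cast Fintype.card_pos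
  have hσ2 : (0 : ℝ) < 2 ^ σ := by positivity
  have ha0 : 0 < a := pos_of_mul_pos_right (hN0.trans hcard) hσ2.le
  -- The overhead `k * N + 1` of the covering is beaten by `q ^ k`; the factor 2 in `hlim` pays for
  -- rounding `k * σ` down to `r`.
  set q : ℝ := N / (2 ^ σ * a) with hq
  have hq0 : 0 ≤ q := by positivity
  have hq1 : q < 1 := (div_lt_one (by positivity)).2 hcard
  have hlim : Tendsto (fun k : ℕ => 2 * (N * (k * q ^ k) + q ^ k)) atTop (𝓝 0) := by
    have h1 := tendsto_pow_const_mul_const_pow_of_abs_lt_one 1 (r := q)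
      (by rwa [abs_of_nonneg hq0])
    have h0 := tendsto_pow_atTop_nhds_zero_of_lt_one hq0 hq1
    simpa using ((h1.const_mul N).add h0).const_mul 2
  obtain ⟨k, hk, hkσ⟩ := ((hlim.eventually (gt_mem_nhds one_pos)).and
    (tendsto_natCast_atTop_atTop.eventually_ge_atTop (1 / σ))).exists
  rw [div_le_iff₀ hσ] at hkσ
  set r : ℕ := ⌊k * σ⌋₊ with hr
  have hr0 : 0 < r := Nat.floor_pos.2 hkσ
  have hrle : (r : ℝ) ≤ k * σ := Nat.floor_le (by positivity)
  have hpow : (2 ^ σ : ℝ) ^ k ≤ 2 * 2 ^ r := by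
    rw [← Real.rpow_mul_natCast zero_le_two, ← pow_succ', ← Real.rpow_natCast]
    refine Real.rpow_le_rpow_of_exponent_le one_le_two ?_
    rw [mul_comm]
    exact_mod_cast (Nat.lt_floor_add_one (k * σ : ℝ)).le
  obtain ⟨f, hf⟩ := hS.exists_separates_pi k (2 ^ r) (k * N + 1) (by
      calc N ^ k ≤ Real.exp N ^ k := by
            gcongr; linarith [Real.add_one_le_exp N]
        _ = Real.exp (k * N) := by rw [Real.exp_nat_mul]
        _ < Real.exp (k * N + 1) := Real.exp_lt_exp.2 (by linarith)) (by
      have hNq : N ^ k = q ^ k * ((2 ^ σ) ^ k * a ^ k) := by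
        rw [← mul_pow, ← mul_pow, hq, div_mul_cancel₀ _ (by positivity)]
      calc (k * N + 1) * N ^ k
          = (2 * (N * (k * q ^ k) + q ^ k)) * ((2 ^ σ) ^ k * a ^ k / 2) := by
            rw [hNq]; ring
        _ ≤ 1 * ((2 ^ σ) ^ k * a ^ k / 2) := by gcongr
        _ = (2 ^ σ) ^ k * a ^ k / 2 := one_mul _
        _ ≤ (2 * 2 ^ r) * a ^ k / 2 := by gcongr
        _ = _ := by push_cast; ring)
  refine ⟨hR, fun j => k * t j, r, hr0,
    hf.nonempty_indexCode (fun i => bitStringMulEquiv k (t i)) (by simp), fun j => ?_⟩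
  rw [le_div_iff₀ (by exact_mod_cast hr0)]
  calc R j * r ≤ R j * (k * σ) := by gcongr; exact hR j
    _ = k * (R j * σ) := by ring
    _ ≤ k * t j := by gcongr; exact hRt j
    _ = _ := by push_cast; rfl

/-- Shrinking `R` by `s < 1` raises the exponent to `ρ / s`, making the cardinality bound strict;
then `s → 1`. -/
theorem ConfusionFree.mem_capacityRegion {V : Type*} [Finite V] {G : Digraph V} {t : V → ℕ}
    {S : Set (∀ i, BitString (t i))} (hS : ConfusionFree G S) {ρ : ℝ} (hρ : 0 < ρ)
    (hcard : (Nat.card (∀ i, BitString (t i)) : ℝ) ≤ 2 ^ ρ * S.ncard)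
    {R : V → ℝ} (hR : ∀ j, 0 ≤ R j) (hRt : ∀ j, R j * ρ ≤ t j) : R ∈ capacityRegion G := by
  have hS0 : (0 : ℝ) < S.ncard :=
    pos_of_mul_pos_right (lt_of_lt_of_le (by exact_mod_cast Nat.card_pos) hcard)
      (by positivity)
  have hlim : Filter.Tendsto (fun s : ℝ => s • R) (nhdsWithin 1 (Set.Iio 1)) (nhds R) := by
    have : Continuous fun s : ℝ => s • R := by fun_prop
    simpa using (this.tendsto 1).mono_left nhdsWithin_le_nhds
  refine mem_closure_of_tendsto hlim ?_
  filter_upwards [Ioo_mem_nhdsLT (zero_lt_one (α := ℝ))] with s ⟨hs0, hs1⟩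
  refine hS.achievable (σ := ρ / s) (by positivity) (hcard.trans_lt ?_)
    (fun j => mul_nonneg hs0.le (hR j)) fun j => ?_
  · gcongr ?_ * _
    refine Real.rpow_lt_rpow_of_exponent_lt one_lt_two ?_
    rw [lt_div_iff₀ hs0]
    exact mul_lt_of_lt_one_right hρ hs1
  · calc s * R j * (ρ / s) = R j * ρ := by field_simp
      _ ≤ t j := hRt j

/-! ### Compactness and degenerate cases -/

theorem capacityRegion_subset_Icc {V : Type*} {G : Digraph V} (hloop : ∀ j, ¬ G.Adj j j) :
    capacityRegion G ⊆ Set.Icc 0 1 := by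
  refine closure_minimal (fun R hR => ?_) isClosed_Icc
  obtain ⟨h0, t, r, hr, ⟨c⟩, hRt⟩ := hR
  refine ⟨h0, fun j => (hRt j).trans ?_⟩
  exact div_le_one_of_le₀ (by exact_mod_cast c.length_le hloop j) (by positivity)

theorem isCompact_capacityRegion {V : Type*} {G : Digraph V} (hloop : ∀ j, ¬ G.Adj j j) :
    IsCompact (capacityRegion G) := by
  refine IsCompact.of_isClosed_subset
    (isCompact_univ_pi fun _ : V => isCompact_Icc (a := (0 : ℝ)) (b := 1))
    isClosed_closure fun R hR j _ => ?_
  have := capacityRegion_subset_Icc hloop hR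
  exact ⟨this.1 j, this.2 j⟩

theorem zero_mem_capacityRegion {V : Type*} (G : Digraph V) : 0 ∈ capacityRegion G := by
  refine subset_closure ⟨fun _ => le_rfl, fun _ => 0, 1, one_pos, ?_, by simp⟩
  exact nonempty_indexCode_of_separates (f := fun _ => default)
    fun _ _ _ _ _ => Subsingleton.elim _ _

/-- In a graph without loops, messages with a confusion-free set of full size are empty. -/
theorem ConfusionFree.length_eq_zero {V : Type*} [Finite V] {G : Digraph V}
    (hloop : ∀ j, ¬ G.Adj j j) {t : V → ℕ} {S : Set (∀ i, BitString (t i))}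
    (hS : ConfusionFree G S) (hcard : Nat.card (∀ i, BitString (t i)) ≤ S.ncard) (j : V) :
    t j = 0 := by
  by_contra hj
  have hj' : (0 : ℝ) < t j := by exact_mod_cast Nat.pos_of_ne_zero hj
  -- Full density allows any `ρ > 0`; `ρ = t j / 2` would give rate 2 at `j`, outside the unit cube.
  have hmem : (fun i => 2 * t i / t j : V → ℝ) ∈ capacityRegion G := by
    refine hS.mem_capacityRegion (ρ := t j / 2) (by positivity) ?_ (fun i => by positivity)
      fun i => by apply le_of_eq; field_simp
    calc (Nat.card (∀ i, BitString (t i)) : ℝ) ≤ 1 * S.ncard := by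
          rw [one_mul]; exact_mod_cast hcard
      _ ≤ _ := by
          gcongr
          exact Real.one_le_rpow one_le_two (by positivity)
  have := (capacityRegion_subset_Icc hloop hmem).2 j
  simp only [Pi.one_apply] at this
  rw [div_le_one hj'] at this
  linarith

/-! ### Splitting a code -/

/-- Messages over `V` are pairs of messages over `V₁` and over `V₂`. -/
theorem bijective_restrict_prod {V : Type*} {V₁ V₂ : Set V} (hdisj : Disjoint V₁ V₂)
    (hcover : V₁ ∪ V₂ = Set.univ) (X : V → Type*) :
    Function.Bijective (fun x : ∀ i, X i =>
      ((fun i : V₁ => x i, fun i : V₂ => x i) : (∀ i : V₁, X i) × (∀ i : V₂, X i))) := by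
  classical
  have hor (i : V) : i ∈ V₁ ∨ i ∈ V₂ := hcover.ge (Set.mem_univ i)
  constructor
  · intro x z h
    rw [Prod.mk.injEq] at h
    funext i
    rcases hor i with hi | hi
    · exact congrFun h.1 ⟨i, hi⟩
    · exact congrFun h.2 ⟨i, hi⟩
  · rintro ⟨x, z⟩
    refine ⟨fun i => if h : i ∈ V₁ then x ⟨i, h⟩ else z ⟨i, (hor i).resolve_left h⟩, ?_⟩
    ext1
    · funext i; simp [i.2]
    · funext i; simp [Set.disjoint_right.1 hdisj i.2]

/-- A code for a graph with no edges between `V₁` and `V₂` yields confusion-free sets for the two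
induced subgraphs whose densities multiply to at least `2 ^ (-r)`. -/
theorem IndexCode.exists_confusionFree {V : Type*} [Finite V] {G : Digraph V}
    {V₁ V₂ : Set V} (hdisj : Disjoint V₁ V₂) (hcover : V₁ ∪ V₂ = Set.univ)
    (hedge : ∀ i ∈ V₁, ∀ j ∈ V₂, ¬ G.Adj i j ∧ ¬ G.Adj j i) {t : V → ℕ} {r : ℕ}
    (c : IndexCode G t r) :
    ∃ (S₁ : Set (∀ i : V₁, BitString (t i))) (S₂ : Set (∀ i : V₂, BitString (t i))),
      ConfusionFree (inducedSubgraph G V₁) S₁ ∧ ConfusionFree (inducedSubgraph G V₂) S₂ ∧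
      Nat.card (∀ i : V₁, BitString (t i)) * Nat.card (∀ i : V₂, BitString (t i)) ≤
        2 ^ r * (S₁.ncard * S₂.ncard) := by
  classical
  have := Fintype.ofFinite V
  have hor (i : V) : i ∈ V₁ ∨ i ∈ V₂ := hcover.ge (Set.mem_univ i)
  have hbij := bijective_restrict_prod hdisj hcover fun i => BitString (t i)
  obtain ⟨y, hy⟩ := Fintype.exists_le_card_fiber_of_nsmul_le_card (M := ℝ) c.encode
    (b := Fintype.card (∀ i, BitString (t i)) / 2 ^ r) (by simp [mul_div_cancel₀])
  set S : Set (∀ i, BitString (t i)) := {x | c.encode x = y} with hS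
  have hfree : ConfusionFree G S := c.separates.confusionFree y
  refine ⟨(fun x i => x i) '' S, (fun x i => x i) '' S, ?_, ?_, ?_⟩
  · rintro _ ⟨x, hx, rfl⟩ _ ⟨z, hz, rfl⟩ ⟨j, hj⟩ hk
    refine hfree x hx z hz j fun k hkj => ?_
    -- Side information of `j` stays inside `V₁`, so agreement there is all that `hfree` needs.
    have hk₁ : k ∈ V₁ := (hor k).resolve_right fun hk₂ => (hedge j hj k hk₂).2 hkj
    exact hk ⟨k, hk₁⟩ hkj
  · rintro _ ⟨x, hx, rfl⟩ _ ⟨z, hz, rfl⟩ ⟨j, hj⟩ hk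
    refine hfree x hx z hz j fun k hkj => ?_
    have hk₂ : k ∈ V₂ := (hor k).resolve_left fun hk₁ => (hedge k hk₁ j hj).1 hkj
    exact hk ⟨k, hk₂⟩ hkj
  · have hX := Nat.card_eq_of_bijective _ hbij
    rw [Nat.card_prod] at hX
    have hSle : S.ncard ≤ ((fun (x : ∀ i, BitString (t i)) (i : V₁) => x i) '' S).ncard
        * ((fun (x : ∀ i, BitString (t i)) (i : V₂) => x i) '' S).ncard := by
      rw [← Set.ncard_prod, ← Set.ncard_image_of_injective S hbij.1]
      refine Set.ncard_le_ncard ?_ (Set.toFinite _)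
      rintro _ ⟨x, hx, rfl⟩
      exact ⟨⟨x, hx, rfl⟩, ⟨x, hx, rfl⟩⟩
    have hpig : Nat.card (∀ i, BitString (t i)) ≤ 2 ^ r * S.ncard := by
      rw [div_le_iff₀ (by positivity)] at hy
      have hcard : (Finset.univ.filter fun x => c.encode x = y).card = S.ncard := by
        rw [← Set.ncard_coe_finset]; congr 1; ext x; simp [hS]
      rw [hcard, mul_comm] at hy
      rw [Nat.card_eq_fintype_card]
      exact_mod_cast hy
    rw [← hX]
    exact hpig.trans (Nat.mul_le_mul_left _ hSle)

/-! ### Time sharing -/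

/-- Time sharing between two codes, with rational weights. -/
theorem achievable_timeSharing {V : Type*} {G : Digraph V} {V₁ V₂ : Set V}
    (hdisj : Disjoint V₁ V₂) (hcover : V₁ ∪ V₂ = Set.univ) {R₁ : V₁ → ℝ} {R₂ : V₂ → ℝ}
    (h₁ : Achievable (inducedSubgraph G V₁) R₁) (h₂ : Achievable (inducedSubgraph G V₂) R₂)
    {q : ℚ} (hq : (q : ℝ) ∈ Set.Icc (0 : ℝ) 1) {R : V → ℝ} (hR₁ : ∀ j : V₁, R j = q * R₁ j)
    (hR₂ : ∀ j : V₂, R j = (1 - q) * R₂ j) : Achievable G R := by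
  classical
  have hor (i : V) : i ∈ V₁ ∨ i ∈ V₂ := hcover.ge (Set.mem_univ i)
  obtain ⟨hq0, hq1⟩ := hq
  obtain ⟨h₁0, t₁, r₁, hr₁, ⟨c₁⟩, hR₁t⟩ := h₁
  obtain ⟨h₂0, t₂, r₂, hr₂, ⟨c₂⟩, hR₂t⟩ := h₂
  obtain ⟨a, b, hb, ha, rfl⟩ : ∃ a b : ℕ, 0 < b ∧ a ≤ b ∧ q = a / b := by
    have hq0' : 0 ≤ q := by exact_mod_cast hq0
    have hq1' : q ≤ 1 := by exact_mod_cast hq1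
    have hqe : q = q.num.toNat / q.den := by
      conv_lhs => rw [← Rat.num_div_den q]
      congr 1
      exact_mod_cast (Int.toNat_of_nonneg (Rat.num_nonneg.2 hq0')).symm
    refine ⟨q.num.toNat, q.den, q.den_pos, ?_, hqe⟩
    rw [hqe, div_le_one (by exact_mod_cast q.den_pos)] at hq1'
    exact_mod_cast hq1'
  have hb' : (0 : ℝ) < b := by exact_mod_cast hb
  have hr₁' : (0 : ℝ) < r₁ := by exact_mod_cast hr₁
  have hr₂' : (0 : ℝ) < r₂ := by exact_mod_cast hr₂
  -- These repetition counts split the total length `b * r₁ * r₂` in the ratio `a : b - a`.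
  obtain ⟨d₁⟩ := c₁.nonempty_nsmul (a * r₂)
  obtain ⟨d₂⟩ := c₂.nonempty_nsmul ((b - a) * r₁)
  let t : V → ℕ := fun i => if h : i ∈ V₁ then a * r₂ * t₁ ⟨i, h⟩
    else (b - a) * r₁ * t₂ ⟨i, (hor i).resolve_left h⟩
  have ht₁ : (fun j : V₁ => t j) = fun j => a * r₂ * t₁ j := by
    funext j; simp [t, j.2]
  have ht₂ : (fun j : V₂ => t j) = fun j => (b - a) * r₁ * t₂ j := by
    funext j; simp [t, Set.disjoint_right.1 hdisj j.2]
  rw [← ht₁] at d₁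
  rw [← ht₂] at d₂
  have hlen : a * r₂ * r₁ + (b - a) * r₁ * r₂ = b * r₁ * r₂ := by
    obtain ⟨d, rfl⟩ := Nat.exists_eq_add_of_le ha
    simp only [Nat.add_sub_cancel_left]; ring
  have hcode := nonempty_indexCode_union hcover d₁ d₂
  rw [hlen] at hcode
  push_cast at hR₁ hR₂ hq0 hq1
  refine ⟨fun j => ?_, t, _, by positivity, hcode, fun j => ?_⟩
  · rcases hor j with hj | hj
    · rw [hR₁ ⟨j, hj⟩]; exact mul_nonneg hq0 (h₁0 _)
    · rw [hR₂ ⟨j, hj⟩]; exact mul_nonneg (sub_nonneg.2 hq1) (h₂0 _)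
  · rcases hor j with hj | hj
    · calc R j = a / b * R₁ ⟨j, hj⟩ := hR₁ ⟨j, hj⟩
        _ ≤ a / b * (t₁ ⟨j, hj⟩ / r₁) := by gcongr; exact hR₁t _
        _ = _ := by
          rw [congrFun ht₁ ⟨j, hj⟩]; push_cast; field_simp
    · calc R j = (1 - a / b) * R₂ ⟨j, hj⟩ := hR₂ ⟨j, hj⟩
        _ ≤ (1 - a / b) * (t₂ ⟨j, hj⟩ / r₂) :=
          mul_le_mul_of_nonneg_left (hR₂t _) (sub_nonneg.2 hq1)
        _ = _ := by
          rw [congrFun ht₂ ⟨j, hj⟩]; push_cast [Nat.cast_sub ha]; field_simp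

/-! ### The union as a continuous image -/

/-- The tuple with weighted parts `α R₁` on `V₁` and `(1 - α) R₂` on the complement. -/
noncomputable def weightedPair {V : Type*} (V₁ V₂ : Set V) (hcover : V₁ ∪ V₂ = Set.univ)
    (p : ℝ × (V₁ → ℝ) × (V₂ → ℝ)) (j : V) : ℝ :=
  open Classical in
  if h : j ∈ V₁ then p.1 * p.2.1 ⟨j, h⟩
  else (1 - p.1) * p.2.2 ⟨j, (hcover ▸ Set.mem_univ j : j ∈ V₁ ∪ V₂).resolve_left h⟩

theorem continuous_weightedPair {V : Type*} {V₁ V₂ : Set V} (hcover : V₁ ∪ V₂ = Set.univ) :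
    Continuous (weightedPair V₁ V₂ hcover) := by
  refine continuous_pi fun j => ?_
  unfold weightedPair
  by_cases h : j ∈ V₁
  · simp only [h, dif_pos]; fun_prop
  · simp only [h, dif_neg, not_false_eq_true]; fun_prop

theorem weightedPair_eq_iff {V : Type*} {V₁ V₂ : Set V} (hdisj : Disjoint V₁ V₂)
    (hcover : V₁ ∪ V₂ = Set.univ) {p : ℝ × (V₁ → ℝ) × (V₂ → ℝ)} {R : V → ℝ} :
    weightedPair V₁ V₂ hcover p = R ↔
      (∀ j : V₁, R j = p.1 * p.2.1 j) ∧ (∀ j : V₂, R j = (1 - p.1) * p.2.2 j) := by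
  constructor
  · rintro rfl
    exact ⟨fun j => by simp [weightedPair, j.2],
      fun j => by simp [weightedPair, Set.disjoint_right.1 hdisj j.2]⟩
  · rintro ⟨h₁, h₂⟩
    funext j
    by_cases h : j ∈ V₁
    · simpa [weightedPair, h] using (h₁ ⟨j, h⟩).symm
    · simpa [weightedPair, h] using
        (h₂ ⟨j, (hcover ▸ Set.mem_univ j : j ∈ V₁ ∪ V₂).resolve_left h⟩).symm

theorem iUnion_eq_image_weightedPair {V : Type*} {V₁ V₂ : Set V} (hdisj : Disjoint V₁ V₂)
    (hcover : V₁ ∪ V₂ = Set.univ) (C₁ : Set (V₁ → ℝ)) (C₂ : Set (V₂ → ℝ)) :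
    (⋃ α ∈ Set.Icc (0 : ℝ) 1, {R : V → ℝ | ∃ R₁ ∈ C₁, ∃ R₂ ∈ C₂,
      (∀ j : V₁, R j = α * R₁ j) ∧ (∀ j : V₂, R j = (1 - α) * R₂ j)}) =
    weightedPair V₁ V₂ hcover '' (Set.Icc (0 : ℝ) 1 ×ˢ C₁ ×ˢ C₂) := by
  ext R
  simp only [Set.mem_iUnion, Set.mem_ofPred_eq, Set.mem_image, Set.mem_prod, Prod.exists,
    weightedPair_eq_iff hdisj hcover, exists_prop]
  constructor
  · rintro ⟨α, hα, R₁, h₁, R₂, h₂, h⟩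
    exact ⟨α, R₁, R₂, ⟨hα, h₁, h₂⟩, h⟩
  · rintro ⟨α, R₁, R₂, ⟨hα, h₁, h₂⟩, h⟩
    exact ⟨α, hα, R₁, h₁, R₂, h₂, h⟩

/-- If `R ρ ≤ t` for the log-density `ρ` of a confusion-free set and `ρ ≤ α r`, then the rates
`R` bounded by `t / r` are `α` times a point of the capacity region. -/
theorem ConfusionFree.exists_mem_capacityRegion_mul {V : Type*} [Finite V] {G : Digraph V}
    (hloop : ∀ j, ¬ G.Adj j j) {t : V → ℕ} {S : Set (∀ i, BitString (t i))}
    (hS : ConfusionFree G S) {α : ℝ} (hα : 0 ≤ α) {r : ℕ} (hr : 0 < r)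
    (hcard : (Nat.card (∀ i, BitString (t i)) : ℝ) ≤ 2 ^ (α * r) * S.ncard) {R : V → ℝ}
    (hR : ∀ j, 0 ≤ R j) (hRt : ∀ j, R j ≤ (t j : ℝ) / r) :
    ∃ R' ∈ capacityRegion G, ∀ j, R j = α * R' j := by
  have hr' : (0 : ℝ) < r := by exact_mod_cast hr
  -- Division by `α` fails at 0, but there `S` is full, so all messages are empty and `R = 0`.
  rcases hα.eq_or_lt with rfl | hα
  · refine ⟨0, zero_mem_capacityRegion G, fun j => ?_⟩
    have ht := hS.length_eq_zero hloop (by simpa using hcard) j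
    have := hRt j
    rw [ht] at this
    simp only [Nat.cast_zero, zero_div] at this
    simp [le_antisymm this (hR j)]
  · refine ⟨fun j => R j / α, hS.mem_capacityRegion (by positivity) hcard
      (fun j => div_nonneg (hR j) hα.le) fun j => ?_, fun j => by field_simp⟩
    calc R j / α * (α * r) = R j * r := by field_simp
      _ ≤ t j := (le_div_iff₀ hr').1 (hRt j)

end IndexCoding

/-! ### The main theorem -/

open IndexCoding in
theorem proposition3 {V : Type*} [Finite V] (G : Digraph V)
    (hloop : ∀ j, ¬ G.Adj j j)
    (V₁ V₂ : Set V) (hdisj : Disjoint V₁ V₂) (hcover : V₁ ∪ V₂ = Set.univ)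
    (hedge : ∀ i ∈ V₁, ∀ j ∈ V₂, ¬ G.Adj i j ∧ ¬ G.Adj j i) :
    IndexCoding.capacityRegion G =
      ⋃ α ∈ Set.Icc (0 : ℝ) 1,
        {R : V → ℝ |
          ∃ R₁ ∈ IndexCoding.capacityRegion (IndexCoding.inducedSubgraph G V₁),
          ∃ R₂ ∈ IndexCoding.capacityRegion (IndexCoding.inducedSubgraph G V₂),
            (∀ j : V₁, R j = α * R₁ j) ∧ (∀ j : V₂, R j = (1 - α) * R₂ j)} := by
  have hloop₁ : ∀ j, ¬ (inducedSubgraph G V₁).Adj j j := fun j => hloop j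
  have hloop₂ : ∀ j, ¬ (inducedSubgraph G V₂).Adj j j := fun j => hloop j
  rw [iUnion_eq_image_weightedPair hdisj hcover]
  apply Set.Subset.antisymm
  · refine closure_minimal ?_ ((isCompact_Icc.prod ((isCompact_capacityRegion hloop₁).prod
      (isCompact_capacityRegion hloop₂))).image (continuous_weightedPair hcover)).isClosed
    rintro R ⟨hR, t, r, hr, ⟨c⟩, hRt⟩
    obtain ⟨S₁, S₂, hS₁, hS₂, hcard⟩ := c.exists_confusionFree hdisj hcover hedge
    have hr' : (0 : ℝ) < r := by exact_mod_cast hr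
    set N₁ : ℕ := Nat.card (∀ i : V₁, BitString (t i)) with hN₁
    set N₂ : ℕ := Nat.card (∀ i : V₂, BitString (t i)) with hN₂
    have hN₁0 : 0 < N₁ := Nat.card_pos
    have hN₂0 : 0 < N₂ := Nat.card_pos
    have hle₁ : S₁.ncard ≤ N₁ := Set.ncard_le_card S₁
    have hle₂ : S₂.ncard ≤ N₂ := Set.ncard_le_card S₂
    have hpos : 0 < S₁.ncard * S₂.ncard :=
      Nat.pos_of_mul_pos_left ((Nat.mul_pos hN₁0 hN₂0).trans_le hcard)
    have hS₁0 : (0 : ℝ) < S₁.ncard := by exact_mod_cast Nat.pos_of_mul_pos_right hpos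
    have hS₂0 : (0 : ℝ) < S₂.ncard := by exact_mod_cast Nat.pos_of_mul_pos_left hpos
    have hN₁0' : (0 : ℝ) < N₁ := by exact_mod_cast hN₁0
    have hN₂0' : (0 : ℝ) < N₂ := by exact_mod_cast hN₂0
    -- `V₁` consumes exactly `ρ` of the `r` bits; `hρr` says that the remaining `r - ρ` suffice for
    -- `V₂`.
    set ρ : ℝ := Real.logb 2 (N₁ / S₁.ncard) with hρ
    have hρ2 : (2 : ℝ) ^ ρ = N₁ / S₁.ncard :=
      Real.rpow_logb two_pos (by norm_num) (by positivity)
    have hρ0 : 0 ≤ ρ := Real.logb_nonneg one_lt_two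
      ((one_le_div hS₁0).2 (by exact_mod_cast hle₁))
    have hcard' : (N₁ * N₂ : ℝ) ≤ 2 ^ r * (S₁.ncard * S₂.ncard) := by exact_mod_cast hcard
    have hρr : (2 : ℝ) ^ ρ * N₂ ≤ 2 ^ (r : ℝ) * S₂.ncard := by
      rw [hρ2, div_mul_eq_mul_div, div_le_iff₀ hS₁0, Real.rpow_natCast]
      linarith
    have hρle : ρ ≤ r := by
      rw [← Real.rpow_le_rpow_left_iff one_lt_two]
      refine le_of_mul_le_mul_right (hρr.trans ?_) hN₂0'
      gcongr
    obtain ⟨R₁, hR₁, hRR₁⟩ := hS₁.exists_mem_capacityRegion_mul hloop₁ (α := ρ / r)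
      (by positivity) hr (by rw [div_mul_cancel₀ _ hr'.ne', hρ2, div_mul_cancel₀ _ hS₁0.ne'])
      (R := fun j => R j) (fun j => hR j) (fun j => hRt j)
    obtain ⟨R₂, hR₂, hRR₂⟩ := hS₂.exists_mem_capacityRegion_mul hloop₂ (α := 1 - ρ / r)
      (sub_nonneg.2 ((div_le_one hr').2 hρle)) hr (by
        rw [sub_mul, one_mul, div_mul_cancel₀ _ hr'.ne', Real.rpow_sub two_pos,
          div_mul_eq_mul_div, le_div_iff₀ (by positivity), mul_comm]
        exact hρr)
      (R := fun j => R j) (fun j => hR j) (fun j => hRt j)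
    exact ⟨(ρ / r, R₁, R₂), ⟨⟨by positivity, (div_le_one hr').2 hρle⟩, hR₁, hR₂⟩,
      (weightedPair_eq_iff hdisj hcover).2 ⟨hRR₁, hRR₂⟩⟩
  -- Time sharing needs rational weights, so real ones are reached as limits.
  · have hdense : Set.Icc (0 : ℝ) 1 ⊆
        closure (Set.range ((↑) : ℚ → ℝ) ∩ Set.Icc 0 1) := by
      refine (closure_Ioo zero_ne_one).ge.trans (closure_minimal ?_ isClosed_closure)
      have := Rat.isDenseEmbedding_coe_real.dense.open_subset_closure_inter
        (isOpen_Ioo (a := (0 : ℝ)) (b := 1))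
      refine this.trans (closure_mono ?_)
      rintro x ⟨hx, hx'⟩
      exact ⟨hx', Set.Ioo_subset_Icc_self hx⟩
    have hsub : Set.Icc (0 : ℝ) 1 ×ˢ capacityRegion (inducedSubgraph G V₁) ×ˢ
        capacityRegion (inducedSubgraph G V₂) ⊆ closure ((Set.range ((↑) : ℚ → ℝ) ∩ Set.Icc 0 1) ×ˢ
          {R | Achievable (inducedSubgraph G V₁) R} ×ˢ
          {R | Achievable (inducedSubgraph G V₂) R}) := by
      rw [closure_prod_eq, closure_prod_eq]
      exact Set.prod_mono hdense le_rfl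
    refine (Set.image_mono hsub).trans
      ((image_closure_subset_closure_image (continuous_weightedPair hcover)).trans
        (closure_mono ?_))
    rintro _ ⟨⟨_, R₁, R₂⟩, ⟨⟨⟨q, rfl⟩, hq⟩, h₁, h₂⟩, rfl⟩
    have := (weightedPair_eq_iff hdisj hcover).1
      (rfl : weightedPair V₁ V₂ hcover ((q : ℝ), R₁, R₂) = _)
    exact achievable_timeSharing hdisj hcover h₁ h₂ hq this.1 this.2
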